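/- Let $\Theta_k=\{(\theta_1,\dots,\theta_k):\theta_i>0,\ \theta_1+\dots+\theta_k<1\}$ and $\theta_{k+1}=1-\theta_1-\dots-\theta_k$. Let $\Pi$ be a prior probability distribution on $\Theta_k$ with density $\pi$ with respect to volume such that (A1) there is $B>0$ with $\pi(\theta)\le B$ for all $\theta\in\Theta_k$, and (A2) the set of points of $\Theta_k$ at which $\pi$ is discontinuous has volume zero. Let $\theta^{\mathrm{true}}\in\Theta_k$ be a point at which $\pi$ is continuous. Let $x=(x_1,x_2,\dots)$ be an i.i.d. sequence of observations, each falling in category $j\in\{1,\dots,k+1\}$ with probability $\theta^{\mathrm{true}}_j$, and let $T_n(x)=(T_1,\dots,T_k)$ be the counts of the first $k$ categories among the first $n$ observations. For $\mathbf t=(t_1,\dots,t_k)$ with $t_i\in\{0,1,2,\dots\}$, $t_1+\dots+t_k\le n$ and $t_{k+1}=n-t_1-\dots-t_k$, let $$m_{T_n}(\mathbf t)=\frac{n!}{\prod_{j=1}^{k+1}t_j!}\int_{\Theta_k}\prod_{j=1}^{k+1}\theta_j^{t_j}\,\pi(\theta)\,d\theta$$ be the prior predictive density of $T_n$, and let $M_{T_n}$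 be the discrete probability distribution with density $m_{T_n}$. Then, for almost every data sequence $x$, $$\Pi\big(\pi(\theta)<\pi(\theta^{\mathrm{true}})\big)\le\liminf_{n\to\infty}M_{T_n}\big(m_{T_n}(\mathbf t)\le m_{T_n}(T_n(x))\big)\le\limsup_{n\to\infty}M_{T_n}\big(m_{T_n}(\mathbf t)\le m_{T_n}(T_n(x))\big)\le\Pi\big(\pi(\theta)\le\pi(\theta^{\mathrm{true}})\big).$$ -/

import Mathlib

open MeasureTheory ProbabilityTheory Filter
open scoped ENNReal

namespace PriorCheck

/-- The open parameter simplex `Θ_k`: all `(θ_1, …, θ_k)` with `θ_i > 0` and `θ_1 + ⋯ + θ_k < 1`. -/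
def simplex (k : ℕ) : Set (Fin k → ℝ) :=
  {θ | (∀ i, 0 < θ i) ∧ ∑ i, θ i < 1}

/-- All `k + 1` cell probabilities: `θ_1, …, θ_k` followed by `θ_{k+1} = 1 - θ_1 - ⋯ - θ_k`. -/
def cellProb {k : ℕ} (θ : Fin k → ℝ) : Fin (k + 1) → ℝ :=
  Fin.snoc (α := fun _ => ℝ) θ (1 - ∑ i, θ i)

/-- The possible values of the counts `T_n = (T_1, …, T_k)`: all `(t_1, …, t_k)` of natural numbers
with `t_1 + ⋯ + t_k ≤ n`. -/
def countVectors (k n : ℕ) : Finset (Fin k → ℕ) :=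
  (Fintype.piFinset fun _ : Fin k => Finset.range (n + 1)).filter fun t => ∑ i, t i ≤ n

/-- All `k + 1` cell counts: `t_1, …, t_k` followed by `t_{k+1} = n - t_1 - ⋯ - t_k`.
It is only used for `t ∈ countVectors k n`, where the subtraction does not truncate. -/
def cellCount {k : ℕ} (n : ℕ) (t : Fin k → ℕ) : Fin (k + 1) → ℕ :=
  Fin.snoc (α := fun _ => ℕ) t (n - ∑ i, t i)

/-- `π` is a probability density on `Θ_k` with respect to volume. Only its values on `Θ_k` matter. -/
structure IsPriorDensity {k : ℕ} (π : (Fin k → ℝ) → ℝ) : Prop where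
  nonneg : ∀ θ ∈ simplex k, 0 ≤ π θ
  aemeasurable : AEMeasurable π (volume.restrict (simplex k))
  lintegral_eq_one : ∫⁻ θ in simplex k, ENNReal.ofReal (π θ) = 1

/-- The prior distribution `Π` on `Θ_k` that has density `π` with respect to volume. -/
noncomputable def prior {k : ℕ} (π : (Fin k → ℝ) → ℝ) : Measure (Fin k → ℝ) :=
  (volume.restrict (simplex k)).withDensity fun θ => ENNReal.ofReal (π θ)

/-- The set `Θ_{k,d}` of the discontinuity points of `π` as a function on `Θ_k`. -/
def discontinuitySet {k : ℕ} (π : (Fin k → ℝ) → ℝ) : Set (Fin k → ℝ) :=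
  {θ | θ ∈ simplex k ∧ ¬ ContinuousWithinAt π (simplex k) θ}

/-- The prior predictive density of the counts,
`m_{T_n}(t) = n! / ∏_j t_j! * ∫_{Θ_k} ∏_j θ_j ^ t_j π(θ) dθ`, the products over `j = 1, …, k + 1`. -/
noncomputable def predictiveDensity {k : ℕ} (π : (Fin k → ℝ) → ℝ) (n : ℕ) (t : Fin k → ℕ) : ℝ :=
  (n.factorial : ℝ) / (∏ j, ((cellCount n t j).factorial : ℝ)) *
    ∫ θ in simplex k, (∏ j, cellProb θ j ^ cellCount n t j) * π θ

/-- The prior predictive distribution `M_{T_n}` of the counts: the discrete distribution that gives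
mass `m_{T_n}(t)` to each possible value `t` of the counts. -/
noncomputable def predictive {k : ℕ} (π : (Fin k → ℝ) → ℝ) (n : ℕ) : Measure (Fin k → ℕ) :=
  ∑ t ∈ countVectors k n, ENNReal.ofReal (predictiveDensity π n t) • Measure.dirac t

/-- The prior-data conflict p-value `M_{T_n}(m_{T_n}(t) ≤ m_{T_n}(s))` at the observed counts `s`. -/
noncomputable def pValue {k : ℕ} (π : (Fin k → ℝ) → ℝ) (n : ℕ) (s : Fin k → ℕ) : ℝ≥0∞ :=
  predictive π n {t | predictiveDensity π n t ≤ predictiveDensity π n s}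

/-- The counts `T_n = (T_1, …, T_k)` of the first `k` categories among the first `n` terms of a
sequence of observed categories. -/
def counts {k : ℕ} (n : ℕ) (x : ℕ → Fin (k + 1)) : Fin k → ℕ :=
  fun j => ((Finset.range n).filter fun i => x i = j.castSucc).card

/-- `X 0, X 1, …` are independent and identically distributed under `P`, each of them
multinomial`(1, θ_1, …, θ_{k+1})`, recorded as the category that is observed. -/
structure IsMultinomialSample {k : ℕ} {Ω : Type*} [MeasurableSpace Ω] (P : Measure Ω)
    (X : ℕ → Ω → Fin (k + 1)) (θ : Fin k → ℝ) : Prop where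
  measurable : ∀ i, Measurable (X i)
  indep : iIndepFun X P
  law : ∀ i c, P {ω | X i ω = c} = ENNReal.ofReal (cellProb θ c)

end PriorCheck

/-! Multiplying `predictiveDensity π n` by (n+k)!/n!, which does not depend on t and so leaves all
comparisons unchanged, turns its value at t into the mean of π under the Dirichlet law with
parameters t_j + 1. That law concentrates near t/n. Hence, if t_n/n tends to a continuity point θ₀
of π in the simplex, the rescaled value tends to π θ₀ (`tendsto_scaled_predictiveDensity`).

By the strong law (`ae_tendsto_counts_div`) this applies almost surely to the observed counts, with
limit π θtrue. It also applies to the grid counts ⌊n y⌋ for almost every y, with limit π y. So π y <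
π θtrue forces the grid count of y into the event of the p-value for all large n, and π y > π θtrue
forces it out.

The predictive mass of an event dominates the integral over y of n^k times the density at ⌊n y⌋,
restricted to that event. The unrestricted integrand tends to π y, so Fatou's lemma gives a lower
bound (`prior_le_liminf_predictive`). The upper bound is the same lemma on complements. Points with
π y = π θtrue remain undecided, whence the gap between < and ≤. -/

namespace PriorCheck

/-! ### Beta and Dirichlet integrals -/

/-- The beta integral with natural exponents over `[0, c]`. -/
theorem integral_pow_mul_sub_pow (c : ℝ) (a b : ℕ) :
    ∫ x in (0 : ℝ)..c, x ^ a * (c - x) ^ b =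
      (a.factorial : ℝ) * b.factorial / (a + b + 1).factorial * c ^ (a + b + 1) := by
  induction b generalizing a with
  | zero =>
    simp only [pow_zero, mul_one, integral_pow, add_zero, Nat.factorial_zero, Nat.factorial_succ]
    push_cast
    have := Nat.cast_ne_zero (R := ℝ).2 (Nat.factorial_ne_zero a)
    field_simp
    simp
  | succ b ih =>
    -- Integration by parts: this product vanishes at both endpoints, so its derivative integrates
    -- to zero and a factor c - x is traded for a factor x.
    have hd : ∀ x ∈ Set.uIcc 0 c, HasDerivAt (fun x : ℝ => x ^ (a + 1) * (c - x) ^ (b + 1))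
        ((a + 1) * (x ^ a * (c - x) ^ (b + 1)) - (b + 1) * (x ^ (a + 1) * (c - x) ^ b)) x := by
      intro x _
      have h1 := (hasDerivAt_pow (a + 1) x).mul (((hasDerivAt_id x).const_sub c).pow (b + 1))
      refine h1.congr_deriv ?_
      simp only [Pi.pow_apply, id_eq, Nat.add_sub_cancel, Nat.cast_add, Nat.cast_one]
      ring
    have h := intervalIntegral.integral_eq_sub_of_hasDerivAt hd
      (Continuous.intervalIntegrable (by fun_prop) _ _)
    rw [intervalIntegral.integral_sub (Continuous.intervalIntegrable (by fun_prop) _ _)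
      (Continuous.intervalIntegrable (by fun_prop) _ _), intervalIntegral.integral_const_mul,
      intervalIntegral.integral_const_mul, ih (a + 1)] at h
    have e : a + 1 + b + 1 = a + (b + 1) + 1 := by ring
    rw [e] at h
    simp only [sub_self, zero_pow (Nat.succ_ne_zero _), mul_zero, zero_mul] at h
    have ha : (a + 1 : ℝ) ≠ 0 := by positivity
    apply mul_left_cancel₀ ha
    rw [sub_eq_zero.1 h, Nat.factorial_succ a, Nat.factorial_succ b]
    push_cast
    ring

theorem lintegral_Ioo_pow_mul_sub_pow {c : ℝ} (hc : 0 < c) (a b : ℕ) :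
    ∫⁻ x in Set.Ioo 0 c, ENNReal.ofReal (x ^ a * (c - x) ^ b) =
      ENNReal.ofReal ((a.factorial : ℝ) * b.factorial / (a + b + 1).factorial *
        c ^ (a + b + 1)) := by
  rw [← integral_pow_mul_sub_pow, intervalIntegral.integral_of_le hc.le,
    integral_Ioc_eq_integral_Ioo, ofReal_integral_eq_lintegral_ofReal]
  · exact (Continuous.integrableOn_Icc (by fun_prop)).mono_set Set.Ioo_subset_Icc_self
  · filter_upwards [ae_restrict_mem measurableSet_Ioo] with x hx
    exact mul_nonneg (pow_nonneg hx.1.le _) (pow_nonneg (sub_nonneg.2 hx.2.le) _)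

theorem measurableSet_scaledSimplex (k : ℕ) (c : ℝ) :
    MeasurableSet {θ : Fin k → ℝ | (∀ i, 0 < θ i) ∧ ∑ i, θ i < c} := by
  simp only [Set.ofPred_and, Set.ofPred_forall]
  exact (MeasurableSet.iInter fun i => measurableSet_lt measurable_const (measurable_pi_apply i)).inter
    (measurableSet_lt (by fun_prop) measurable_const)

/-- The Dirichlet integral with natural exponents over the simplex of size `c`. -/
theorem lintegral_dirichlet (k : ℕ) (t : Fin k → ℕ) (s : ℕ) {c : ℝ} (hc : 0 < c) :
    ∫⁻ θ, {θ : Fin k → ℝ | (∀ i, 0 < θ i) ∧ ∑ i, θ i < c}.indicator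
        (fun θ => ENNReal.ofReal ((∏ i, θ i ^ t i) * (c - ∑ i, θ i) ^ s)) θ =
      ENNReal.ofReal ((∏ i, ((t i).factorial : ℝ)) * s.factorial /
        (∑ i, t i + s + k).factorial * c ^ (∑ i, t i + s + k)) := by
  induction k generalizing c with
  | zero =>
    have := Nat.cast_ne_zero (R := ℝ).2 (Nat.factorial_ne_zero s)
    simp [hc, volume_pi, this]
  | succ k ih =>
    -- Split off coordinate 0: the slice at x is the simplex of size c - x, so the induction needs
    -- every c; a beta integral in x remains.
    rw [← (volume_preserving_piFinSuccAbove (fun _ : Fin (k + 1) => ℝ) 0).symm.lintegral_comp_emb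
      (MeasurableEquiv.measurableEmbedding _), Measure.volume_eq_prod, lintegral_prod]
    · have key : ∀ x : ℝ, ∫⁻ y : Fin k → ℝ,
          {θ : Fin (k + 1) → ℝ | (∀ i, 0 < θ i) ∧ ∑ i, θ i < c}.indicator
            (fun θ => ENNReal.ofReal ((∏ i, θ i ^ t i) * (c - ∑ i, θ i) ^ s))
            ((MeasurableEquiv.piFinSuccAbove (fun _ : Fin (k + 1) => ℝ) 0).symm (x, y)) =
          (Set.Ioo 0 c).indicator (fun x => ENNReal.ofReal
              ((∏ i : Fin k, ((t i.succ).factorial : ℝ)) * s.factorial / (∑ i : Fin k, t i.succ + s + k).factorial) *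
            ENNReal.ofReal (x ^ t 0 * (c - x) ^ (∑ i : Fin k, t i.succ + s + k))) x := by
        intro x
        by_cases hx : x ∈ Set.Ioo 0 c
        · rw [Set.indicator_of_mem hx, ← ENNReal.ofReal_mul (by positivity)]
          have h1 : 0 ≤ x ^ t 0 := pow_nonneg hx.1.le _
          have h2 := ih (fun i => t i.succ) (c := c - x) (by linarith [hx.2])
          rw [show ∀ A B : ℝ, A * (x ^ t 0 * B) = x ^ t 0 * (A * B) from fun A B => by ring,
            ENNReal.ofReal_mul h1, ← h2, ← lintegral_const_mul' _ _ ENNReal.ofReal_ne_top]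
          congr 1
          ext y
          simp only [Set.indicator, Set.mem_ofPred_eq, MeasurableEquiv.piFinSuccAbove_symm_apply,
            Fin.insertNthEquiv_apply, Fin.insertNth_zero', Fin.forall_fin_succ, Fin.cons_zero,
            Fin.cons_succ, Fin.sum_univ_succ, Fin.prod_univ_succ, hx.1, true_and,
            ← lt_sub_iff_add_lt', mul_ite, mul_zero]
          refine if_congr Iff.rfl ?_ rfl
          rw [← ENNReal.ofReal_mul h1]
          congr 1
          rw [sub_sub]; ring
        · rw [Set.indicator_of_notMem hx]
          convert lintegral_zero with y
          refine Set.indicator_of_notMem ?_ _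
          rintro ⟨h1, h2⟩
          simp only [MeasurableEquiv.piFinSuccAbove_symm_apply,
            Fin.insertNthEquiv_apply, Fin.insertNth_zero', Fin.forall_fin_succ, Fin.cons_zero,
            Fin.cons_succ, Fin.sum_univ_succ] at h1 h2
          have := Finset.sum_nonneg fun i (_ : i ∈ Finset.univ) => (h1.2 i).le
          exact hx ⟨h1.1, by linarith⟩
      simp_rw [key]
      rw [lintegral_indicator measurableSet_Ioo, lintegral_const_mul' _ _ ENNReal.ofReal_ne_top,
        lintegral_Ioo_pow_mul_sub_pow hc, ← ENNReal.ofReal_mul (by positivity)]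
      congr 1
      have e : t 0 + (∑ i : Fin k, t i.succ + s + k) + 1 = ∑ i, t i + s + (k + 1) := by
        rw [Fin.sum_univ_succ]; ring
      rw [e, Fin.prod_univ_succ]
      field_simp
    · refine Measurable.aemeasurable ?_
      refine Measurable.comp (Measurable.indicator (by fun_prop) ?_) (MeasurableEquiv.measurable _)
      exact measurableSet_scaledSimplex _ c

/-! ### Cell counts and Dirichlet moments -/

theorem measurableSet_simplex (k : ℕ) : MeasurableSet (simplex k) :=
  measurableSet_scaledSimplex k 1

theorem prod_cellProb_pow {k : ℕ} (θ : Fin k → ℝ) (n : ℕ) (t : Fin k → ℕ) :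
    ∏ j, cellProb θ j ^ cellCount n t j = (∏ i, θ i ^ t i) * (1 - ∑ i, θ i) ^ (n - ∑ i, t i) := by
  simp [Fin.prod_univ_castSucc, cellProb, cellCount]

theorem prod_factorial_cellCount {k : ℕ} (n : ℕ) (t : Fin k → ℕ) :
    ∏ j, ((cellCount n t j).factorial : ℝ) =
      (∏ i, ((t i).factorial : ℝ)) * ((n - ∑ i, t i).factorial : ℝ) := by
  simp [Fin.prod_univ_castSucc, cellCount]

theorem sum_le_of_mem_countVectors {k n : ℕ} {t : Fin k → ℕ} (ht : t ∈ countVectors k n) :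
    ∑ i, t i ≤ n :=
  (Finset.mem_filter.1 ht).2

theorem mem_countVectors {k n : ℕ} {t : Fin k → ℕ} :
    t ∈ countVectors k n ↔ ∑ i, t i ≤ n := by
  refine ⟨sum_le_of_mem_countVectors, fun h => Finset.mem_filter.2 ⟨?_, h⟩⟩
  simp only [Fintype.mem_piFinset, Finset.mem_range, Nat.lt_succ_iff]
  exact fun i => (Finset.single_le_sum (fun j _ => Nat.zero_le (t j)) (Finset.mem_univ i)).trans h

/-- The unnormalized Dirichlet density with natural exponents. -/
noncomputable def dirichletKernel {k : ℕ} (t : Fin k → ℕ) (s : ℕ) (θ : Fin k → ℝ) : ℝ :=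
  (∏ i, θ i ^ t i) * (1 - ∑ i, θ i) ^ s

/-- The integral of the unnormalized Dirichlet density. -/
noncomputable def dirichletMass {k : ℕ} (t : Fin k → ℕ) (s : ℕ) : ℝ :=
  (∏ i, ((t i).factorial : ℝ)) * s.factorial / (∑ i, t i + s + k).factorial

theorem dirichletMass_pos {k : ℕ} (t : Fin k → ℕ) (s : ℕ) : 0 < dirichletMass t s := by
  unfold dirichletMass; positivity

theorem dirichletKernel_nonneg {k : ℕ} (t : Fin k → ℕ) (s : ℕ) {θ : Fin k → ℝ}
    (hθ : θ ∈ simplex k) : 0 ≤ dirichletKernel t s θ :=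
  mul_nonneg (Finset.prod_nonneg fun i _ => pow_nonneg (hθ.1 i).le _)
    (pow_nonneg (sub_nonneg.2 hθ.2.le) _)

theorem lintegral_dirichletKernel {k : ℕ} (t : Fin k → ℕ) (s : ℕ) :
    ∫⁻ θ in simplex k, ENNReal.ofReal (dirichletKernel t s θ) =
      ENNReal.ofReal (dirichletMass t s) := by
  rw [← lintegral_indicator (measurableSet_simplex k)]
  have h := lintegral_dirichlet k t s one_pos
  rw [one_pow, mul_one] at h
  exact h

theorem ae_dirichletKernel_nonneg {k : ℕ} (t : Fin k → ℕ) (s : ℕ) :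
    0 ≤ᵐ[volume.restrict (simplex k)] dirichletKernel t s := by
  filter_upwards [ae_restrict_mem (measurableSet_simplex k)] with θ hθ
  exact dirichletKernel_nonneg t s hθ

theorem continuous_dirichletKernel {k : ℕ} (t : Fin k → ℕ) (s : ℕ) :
    Continuous (dirichletKernel t s) := by
  unfold dirichletKernel; fun_prop

theorem integrableOn_dirichletKernel {k : ℕ} (t : Fin k → ℕ) (s : ℕ) :
    IntegrableOn (dirichletKernel t s) (simplex k) := by
  refine ⟨(continuous_dirichletKernel t s).aestronglyMeasurable, ?_⟩
  rw [hasFiniteIntegral_iff_ofReal (ae_dirichletKernel_nonneg t s), lintegral_dirichletKernel]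
  exact ENNReal.ofReal_lt_top

theorem integral_dirichletKernel {k : ℕ} (t : Fin k → ℕ) (s : ℕ) :
    ∫ θ in simplex k, dirichletKernel t s θ = dirichletMass t s := by
  rw [integral_eq_lintegral_of_nonneg_ae (ae_dirichletKernel_nonneg t s)
    (continuous_dirichletKernel t s).aestronglyMeasurable, lintegral_dirichletKernel,
    ENNReal.toReal_ofReal (dirichletMass_pos t s).le]

theorem dirichletKernel_add_single {k : ℕ} (t : Fin k → ℕ) (s : ℕ) (i : Fin k) (θ : Fin k → ℝ) :
    dirichletKernel (t + Pi.single i 1) s θ = dirichletKernel t s θ * θ i := by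
  have : ∏ j, θ j ^ (Pi.single i 1 : Fin k → ℕ) j = θ i := by
    rw [Finset.prod_eq_single i] <;> simp +contextual
  simp only [dirichletKernel, Pi.add_apply, pow_add, Finset.prod_mul_distrib, this]
  ring

/-- The ratio of the two masses is the Dirichlet mean of coordinate i; using it twice yields the
second moment. -/
theorem dirichletMass_add_single {k : ℕ} (t : Fin k → ℕ) (s : ℕ) (i : Fin k) :
    dirichletMass (t + Pi.single i 1) s =
      dirichletMass t s * ((t i + 1) / (∑ i, t i + s + k + 1)) := by
  have h1 : ∏ j, (((t + Pi.single i 1 : Fin k → ℕ) j).factorial : ℝ) =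
      (∏ j, ((t j).factorial : ℝ)) * (t i + 1) := by
    have : ∀ j, (((t + Pi.single i 1 : Fin k → ℕ) j).factorial : ℝ) =
        (t j).factorial * if j = i then (t i + 1 : ℝ) else 1 := by
      intro j
      by_cases h : j = i
      · subst h; simp [Nat.factorial_succ, mul_comm]
      · simp [h]
    simp_rw [this, Finset.prod_mul_distrib]
    simp
  have h2 : ∑ j, (t + Pi.single i 1 : Fin k → ℕ) j + s + k = (∑ j, t j + s + k) + 1 := by
    simp [Finset.sum_add_distrib]; ring
  rw [dirichletMass, dirichletMass, h1, h2, Nat.factorial_succ]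
  push_cast
  field_simp

/-- The mean squared distance of a coordinate from a point, under a Dirichlet distribution. -/
theorem integral_dirichletKernel_mul_sq {k : ℕ} (t : Fin k → ℕ) (s : ℕ) (i : Fin k) (a : ℝ) :
    IntegrableOn (fun θ => dirichletKernel t s θ * (θ i - a) ^ 2) (simplex k) ∧
    ∫ θ in simplex k, dirichletKernel t s θ * (θ i - a) ^ 2 = dirichletMass t s *
      ((t i + 1) / (∑ i, t i + s + k + 1) * ((t i + 2) / (∑ i, t i + s + k + 2)) -
        2 * a * ((t i + 1) / (∑ i, t i + s + k + 1)) + a ^ 2) := by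
  have e : (fun θ : Fin k → ℝ => dirichletKernel t s θ * (θ i - a) ^ 2) = fun θ =>
      dirichletKernel (t + Pi.single i 1 + Pi.single i 1) s θ
        - 2 * a * dirichletKernel (t + Pi.single i 1) s θ + a ^ 2 * dirichletKernel t s θ := by
    ext θ
    simp only [dirichletKernel_add_single]
    ring
  have i2 := integrableOn_dirichletKernel (t + Pi.single i 1 + Pi.single i 1) s
  have i1 := (integrableOn_dirichletKernel (t + Pi.single i 1) s).const_mul (2 * a)
  have i0 := (integrableOn_dirichletKernel t s).const_mul (a ^ 2)
  have i21 : Integrable (fun θ => dirichletKernel (t + Pi.single i 1 + Pi.single i 1) s θ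
      - 2 * a * dirichletKernel (t + Pi.single i 1) s θ) (volume.restrict (simplex k)) := i2.sub i1
  rw [e]
  refine ⟨i21.add i0, ?_⟩
  rw [integral_add i21 i0, integral_sub i2 i1, integral_const_mul, integral_const_mul]
  simp only [integral_dirichletKernel, dirichletMass_add_single]
  have : ((∑ j, (t + Pi.single i 1 : Fin k → ℕ) j : ℕ) : ℝ) = (∑ j, t j : ℕ) + 1 := by
    simp [Finset.sum_add_distrib]
  push_cast at this ⊢
  simp only [Pi.add_apply, Pi.single_eq_same, Nat.cast_add, Nat.cast_one] at this ⊢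
  rw [this]
  ring_nf

/-! ### Local limit of the predictive density -/

theorem integral_density {k : ℕ} {π : (Fin k → ℝ) → ℝ} (hπ : IsPriorDensity π) :
    ∫ θ in simplex k, π θ = 1 := by
  rw [integral_eq_lintegral_of_nonneg_ae _ hπ.aemeasurable.aestronglyMeasurable,
    hπ.lintegral_eq_one, ENNReal.toReal_one]
  filter_upwards [ae_restrict_mem (measurableSet_simplex k)] with θ hθ using hπ.nonneg θ hθ

theorem integrableOn_dirichletKernel_mul {k : ℕ} {π : (Fin k → ℝ) → ℝ} (hπ : IsPriorDensity π)
    {B : ℝ} (hB : ∀ θ ∈ simplex k, π θ ≤ B) (t : Fin k → ℕ) (s : ℕ) :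
    IntegrableOn (fun θ => dirichletKernel t s θ * π θ) (simplex k) := by
  refine (integrableOn_dirichletKernel t s).mul_bdd (c := B) hπ.aemeasurable.aestronglyMeasurable ?_
  filter_upwards [ae_restrict_mem (measurableSet_simplex k)] with θ hθ
  rw [Real.norm_eq_abs, abs_of_nonneg (hπ.nonneg θ hθ)]
  exact hB θ hθ

/-- The prior predictive density is proportional to a Dirichlet expectation of the prior density,
with a factor that depends on the sample size only. -/
theorem factorial_div_mul_predictiveDensity {k n : ℕ} (π : (Fin k → ℝ) → ℝ) {t : Fin k → ℕ}
    (ht : t ∈ countVectors k n) :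
    ((n + k).factorial : ℝ) / n.factorial * predictiveDensity π n t =
      (dirichletMass t (n - ∑ i, t i))⁻¹ *
        ∫ θ in simplex k, dirichletKernel t (n - ∑ i, t i) θ * π θ := by
  have h := sum_le_of_mem_countVectors ht
  rw [predictiveDensity, prod_factorial_cellCount, dirichletMass, Nat.add_sub_cancel' h]
  simp only [prod_cellProb_pow]
  have h1 : (n.factorial : ℝ) ≠ 0 := by positivity
  simp only [dirichletKernel]
  rw [← mul_assoc]
  congr 1
  field_simp

theorem predictiveDensity_nonneg {k n : ℕ} {π : (Fin k → ℝ) → ℝ} (hπ : IsPriorDensity π)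
    (t : Fin k → ℕ) : 0 ≤ predictiveDensity π n t := by
  refine mul_nonneg (by positivity) (setIntegral_nonneg (measurableSet_simplex k) fun θ hθ => ?_)
  rw [prod_cellProb_pow]
  exact mul_nonneg (dirichletKernel_nonneg t _ hθ) (hπ.nonneg θ hθ)

/-- Within distance δ of θ₀ continuity gives ε. Farther away the sum of squares is at least δ² while
the left side is at most B, so K = B/δ² works. With a quadratic bound, two Dirichlet moments
suffice, as in Chebyshev's inequality. -/
theorem exists_abs_sub_le_sum_sq {k : ℕ} {π : (Fin k → ℝ) → ℝ} (hπ : IsPriorDensity π)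
    {B : ℝ} (hB : ∀ θ ∈ simplex k, π θ ≤ B) {θ₀ : Fin k → ℝ} (hθ₀ : θ₀ ∈ simplex k)
    (hc : ContinuousWithinAt π (simplex k) θ₀) {ε : ℝ} (hε : 0 < ε) :
    ∃ K, ∀ θ ∈ simplex k, |π θ - π θ₀| ≤ ε + K * ∑ i, (θ i - θ₀ i) ^ 2 := by
  obtain ⟨δ, hδ, h⟩ := Metric.continuousWithinAt_iff.1 hc ε hε
  have hB0 : 0 ≤ B := (hπ.nonneg _ hθ₀).trans (hB _ hθ₀)
  refine ⟨B / δ ^ 2, fun θ hθ => ?_⟩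
  have hs : 0 ≤ ∑ i, (θ i - θ₀ i) ^ 2 := Finset.sum_nonneg fun i _ => sq_nonneg _
  by_cases hd : dist θ θ₀ < δ
  · have := (h hθ hd).le
    rw [Real.dist_eq] at this
    exact this.trans (le_add_of_nonneg_right (by positivity))
  · rw [dist_pi_lt_iff hδ] at hd
    push Not at hd
    obtain ⟨i, hi⟩ := hd
    have h1 : δ ^ 2 ≤ ∑ i, (θ i - θ₀ i) ^ 2 := by
      refine le_trans ?_ (Finset.single_le_sum (f := fun i => (θ i - θ₀ i) ^ 2)
        (fun j _ => sq_nonneg _) (Finset.mem_univ i))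
      rw [Real.dist_eq] at hi
      rw [← sq_abs (θ i - θ₀ i)]
      gcongr
    have h2 : B ≤ B / δ ^ 2 * ∑ i, (θ i - θ₀ i) ^ 2 := by
      rw [div_mul_eq_mul_div, le_div_iff₀ (by positivity)]
      gcongr
    have := hπ.nonneg _ hθ₀
    have := hπ.nonneg _ hθ
    have := hB _ hθ₀
    have := hB _ hθ
    exact abs_le.2 ⟨by linarith, by linarith⟩

theorem abs_dirichlet_mean_sub_le {k : ℕ} {π : (Fin k → ℝ) → ℝ} (hπ : IsPriorDensity π)
    {B : ℝ} (hB : ∀ θ ∈ simplex k, π θ ≤ B) {θ₀ : Fin k → ℝ} {p ε K : ℝ}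
    (hK : ∀ θ ∈ simplex k, |π θ - p| ≤ ε + K * ∑ i, (θ i - θ₀ i) ^ 2)
    (t : Fin k → ℕ) (s : ℕ) :
    |(dirichletMass t s)⁻¹ * (∫ θ in simplex k, dirichletKernel t s θ * π θ) - p| ≤
      ε + K * ∑ i, ((t i + 1) / (∑ i, t i + s + k + 1) * ((t i + 2) / (∑ i, t i + s + k + 2)) -
        2 * θ₀ i * ((t i + 1) / (∑ i, t i + s + k + 1)) + θ₀ i ^ 2) := by
  have hD := dirichletMass_pos t s
  have i0 := integrableOn_dirichletKernel t s
  have iπ := integrableOn_dirichletKernel_mul hπ hB t s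
  have e : (dirichletMass t s)⁻¹ * (∫ θ in simplex k, dirichletKernel t s θ * π θ) - p =
      (dirichletMass t s)⁻¹ * ∫ θ in simplex k, dirichletKernel t s θ * (π θ - p) := by
    simp_rw [mul_sub]
    rw [integral_sub iπ (i0.mul_const p), integral_mul_const, integral_dirichletKernel]
    field_simp
  have isum : IntegrableOn (fun θ => ∑ i, dirichletKernel t s θ * (θ i - θ₀ i) ^ 2)
      (simplex k) := integrable_finsetSum _ fun i _ => (integral_dirichletKernel_mul_sq t s i _).1
  have ibound : IntegrableOn (fun θ => ε * dirichletKernel t s θ +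
      K * ∑ i, dirichletKernel t s θ * (θ i - θ₀ i) ^ 2) (simplex k) :=
    (i0.const_mul ε).add (isum.const_mul K)
  rw [e, abs_mul, abs_of_pos (inv_pos.2 hD), inv_mul_le_iff₀ hD]
  calc |∫ θ in simplex k, dirichletKernel t s θ * (π θ - p)|
      ≤ ∫ θ in simplex k, (ε * dirichletKernel t s θ +
          K * ∑ i, dirichletKernel t s θ * (θ i - θ₀ i) ^ 2) := by
        rw [← Real.norm_eq_abs]
        refine norm_integral_le_of_norm_le ibound ?_
        filter_upwards [ae_restrict_mem (measurableSet_simplex k)] with θ hθ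
        have h0 := dirichletKernel_nonneg t s hθ
        rw [norm_mul, Real.norm_eq_abs, Real.norm_eq_abs, abs_of_nonneg h0, ← Finset.mul_sum]
        calc _ ≤ _ := mul_le_mul_of_nonneg_left (hK θ hθ) h0
          _ = _ := by ring
    _ = _ := by
        rw [integral_add (i0.const_mul ε) (isum.const_mul K), integral_const_mul,
          integral_const_mul, integral_dirichletKernel,
          integral_finsetSum _ fun i _ => (integral_dirichletKernel_mul_sq t s i _).1]
        simp_rw [(integral_dirichletKernel_mul_sq t s _ _).2]
        rw [← Finset.mul_sum]
        ring

/-- Both quotients tend to a, so the limit is a² - 2a·a + a² = 0. -/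
theorem tendsto_dirichlet_second_moment {k : ℕ} {m : ℕ → ℕ} {a : ℝ}
    (h : Tendsto (fun n => (m n : ℝ) / n) atTop (nhds a)) :
    Tendsto (fun n : ℕ => ((m n : ℝ) + 1) / (n + k + 1) * ((m n + 2) / (n + k + 2)) -
        2 * a * ((m n + 1) / (n + k + 1)) + a ^ 2) atTop (nhds 0) := by
  have aux : ∀ b c : ℝ, Tendsto (fun n : ℕ => ((m n : ℝ) + b) / (n + c)) atTop (nhds a) := by
    intro b c
    have h1 : Tendsto (fun n : ℕ => ((m n : ℝ) / n + b / n) / (1 + c / n)) atTop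
        (nhds ((a + 0) / (1 + 0))) :=
      (h.add (tendsto_const_div_atTop_nhds_zero_nat b)).div
        (tendsto_const_nhds.add (tendsto_const_div_atTop_nhds_zero_nat c)) (by simp)
    rw [add_zero, add_zero, div_one] at h1
    refine h1.congr' ?_
    filter_upwards [eventually_gt_atTop 0] with n hn
    have : (n : ℝ) ≠ 0 := by positivity
    rw [← add_div, ← div_self this, ← add_div, div_div_div_cancel_right₀ this]
  have h1 := aux 1 (k + 1)
  have h2 := aux 2 (k + 2)
  have h3 := ((h1.mul h2).sub (h1.const_mul (2 * a))).add_const (a ^ 2)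
  simp only [← add_assoc] at h3
  convert h3 using 2
  ring

/-- Along counts whose frequencies converge to a continuity point, the rescaled prior predictive
density converges to the prior density. -/
theorem tendsto_scaled_predictiveDensity {k : ℕ} {π : (Fin k → ℝ) → ℝ} (hπ : IsPriorDensity π)
    {B : ℝ} (hB : ∀ θ ∈ simplex k, π θ ≤ B) {θ₀ : Fin k → ℝ} (hθ₀ : θ₀ ∈ simplex k)
    (hc : ContinuousWithinAt π (simplex k) θ₀) {t : ℕ → Fin k → ℕ}
    (ht : ∀ n, t n ∈ countVectors k n)
    (hlim : ∀ i, Tendsto (fun n => (t n i : ℝ) / n) atTop (nhds (θ₀ i))) :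
    Tendsto (fun n : ℕ => ((n + k).factorial : ℝ) / n.factorial * predictiveDensity π n (t n))
      atTop (nhds (π θ₀)) := by
  rw [Metric.tendsto_nhds]
  intro ε hε
  obtain ⟨K, hK⟩ := exists_abs_sub_le_sum_sq hπ hB hθ₀ hc (half_pos hε)
  have hsum := (tendsto_finsetSum Finset.univ fun i _ =>
    tendsto_dirichlet_second_moment (k := k) (hlim i)).const_mul K
  rw [Finset.sum_const_zero, mul_zero] at hsum
  filter_upwards [hsum.eventually_lt_const (half_pos hε)] with n hn
  rw [Real.dist_eq, factorial_div_mul_predictiveDensity π (ht n)]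
  refine (abs_dirichlet_mean_sub_le hπ hB hK _ _).trans_lt ?_
  rw [← Nat.cast_add, Nat.add_sub_cancel' (sum_le_of_mem_countVectors (ht n))]
  linarith

/-! ### Total mass of the predictive distribution -/

/-- The multinomial probabilities add up to one. -/
theorem sum_multinomial_eq_one {k : ℕ} (n : ℕ) (θ : Fin k → ℝ) :
    ∑ t ∈ countVectors k n, (n.factorial : ℝ) / (∏ j, ((cellCount n t j).factorial : ℝ)) *
      ∏ j, cellProb θ j ^ cellCount n t j = 1 := by
  have h1 : ∑ j, cellProb θ j = 1 := by simp [Fin.sum_univ_castSucc, cellProb]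
  have h := Finset.sum_pow_eq_sum_piAntidiag Finset.univ (cellProb θ) n
  rw [h1, one_pow] at h
  rw [h]
  -- The last cell count is determined by the others, which matches t with the exponent vectors of
  -- total n in the multinomial theorem.
  refine Finset.sum_bij' (fun t _ => cellCount n t) (fun u _ => fun i => u i.castSucc) ?_ ?_ ?_ ?_ ?_
  · intro t ht
    have := sum_le_of_mem_countVectors ht
    simp [Finset.mem_piAntidiag, Fin.sum_univ_castSucc, cellCount, this]
  · intro u hu
    have hu := (Finset.mem_piAntidiag.1 hu).1
    rw [Fin.sum_univ_castSucc] at hu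
    exact mem_countVectors.2 (by omega)
  · intro t _
    ext i
    simp [cellCount]
  · intro u hu
    have hu := (Finset.mem_piAntidiag.1 hu).1
    rw [Fin.sum_univ_castSucc] at hu
    ext j
    refine Fin.lastCases ?_ (fun i => ?_) j
    · simp only [cellCount, Fin.snoc_last]; omega
    · simp [cellCount]
  · intro t ht
    have hs : ∑ j, cellCount n t j = n := by
      have := sum_le_of_mem_countVectors ht
      simp [Fin.sum_univ_castSucc, cellCount, this]
    rw [Nat.multinomial, hs, Nat.cast_div, Nat.cast_prod]
    · have h := Nat.prod_factorial_dvd_factorial_sum Finset.univ (cellCount n t)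
      rwa [hs] at h
    · positivity

theorem sum_predictiveDensity {k : ℕ} {π : (Fin k → ℝ) → ℝ} (hπ : IsPriorDensity π)
    {B : ℝ} (hB : ∀ θ ∈ simplex k, π θ ≤ B) (n : ℕ) :
    ∑ t ∈ countVectors k n, predictiveDensity π n t = 1 := by
  simp only [predictiveDensity, ← integral_const_mul]
  rw [← integral_finsetSum]
  · simp_rw [← mul_assoc, ← Finset.sum_mul, sum_multinomial_eq_one, one_mul]
    exact integral_density hπ
  · intro t _
    simp only [prod_cellProb_pow]
    exact (integrableOn_dirichletKernel_mul hπ hB t _).const_mul _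

open Classical in
theorem predictive_apply {k : ℕ} (π : (Fin k → ℝ) → ℝ) (n : ℕ) (A : Set (Fin k → ℕ)) :
    predictive π n A = ∑ t ∈ countVectors k n,
      A.indicator (fun t => ENNReal.ofReal (predictiveDensity π n t)) t := by
  simp [predictive, Set.indicator_apply]

theorem predictive_univ {k : ℕ} {π : (Fin k → ℝ) → ℝ} (hπ : IsPriorDensity π)
    {B : ℝ} (hB : ∀ θ ∈ simplex k, π θ ≤ B) (n : ℕ) : predictive π n Set.univ = 1 := by
  simp only [predictive_apply, Set.indicator_univ]
  rw [← ENNReal.ofReal_sum_of_nonneg fun t _ => predictiveDensity_nonneg hπ t,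
    sum_predictiveDensity hπ hB, ENNReal.ofReal_one]

/-! ### Riemann sums over the grid of mesh 1/n -/

/-- The counts whose frequencies are the coordinates rounded down to multiples of `1 / n`. -/
noncomputable def gridCount {k : ℕ} (n : ℕ) (y : Fin k → ℝ) : Fin k → ℕ :=
  fun i => ⌊y i * n⌋₊

theorem measurable_gridCount {k : ℕ} (n : ℕ) : Measurable (gridCount (k := k) n) := by
  unfold gridCount; fun_prop

theorem gridCount_mem {k : ℕ} (n : ℕ) {y : Fin k → ℝ} (hy : y ∈ simplex k) :
    gridCount n y ∈ countVectors k n := by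
  rw [mem_countVectors]
  have : ((∑ i, gridCount n y i : ℕ) : ℝ) ≤ n := by
    push_cast
    calc ∑ i, (gridCount n y i : ℝ) ≤ ∑ i, y i * n :=
          Finset.sum_le_sum fun i _ => Nat.floor_le (mul_nonneg (hy.1 i).le n.cast_nonneg)
      _ = (∑ i, y i) * n := by rw [Finset.sum_mul]
      _ ≤ n := mul_le_of_le_one_left n.cast_nonneg hy.2.le
  exact_mod_cast this

theorem tendsto_gridCount_div {k : ℕ} {y : Fin k → ℝ} (hy : y ∈ simplex k) (i : Fin k) :
    Tendsto (fun n : ℕ => (gridCount n y i : ℝ) / n) atTop (nhds (y i)) :=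
  (tendsto_nat_floor_mul_div_atTop (hy.1 i).le).comp tendsto_natCast_atTop_atTop

/-- The grid cell lies in a cube of side 1/n. Cells cut by the boundary of the simplex may be
smaller; an upper bound is all that the Riemann sum needs. -/
theorem volume_gridCount_le {k n : ℕ} (hn : 0 < n) (t : Fin k → ℕ) :
    volume (simplex k ∩ {y | gridCount n y = t}) ≤ ENNReal.ofReal (((n : ℝ) ^ k)⁻¹) := by
  have hn' : (0 : ℝ) < n := by positivity
  calc volume (simplex k ∩ {y | gridCount n y = t})
      ≤ volume (Set.univ.pi fun i => Set.Ico ((t i : ℝ) / n) ((t i + 1) / n)) := by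
        refine measure_mono ?_
        rintro y ⟨hy, hyt⟩ i -
        have h := congrFun hyt i
        rw [gridCount, Nat.floor_eq_iff (mul_nonneg (hy.1 i).le hn'.le)] at h
        exact ⟨(div_le_iff₀ hn').2 h.1, (lt_div_iff₀ hn').2 h.2⟩
    _ = ENNReal.ofReal (((n : ℝ) ^ k)⁻¹) := by
        rw [Real.volume_pi_Ico]
        simp only [← sub_div, add_sub_cancel_left, Finset.prod_const, Finset.card_univ,
          Fintype.card_fin, one_div]
        rw [← ENNReal.ofReal_pow (by positivity), inv_pow]

/-- A Riemann sum dominates the integral of the corresponding step function on the simplex. -/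
theorem lintegral_gridCount_le {k n : ℕ} (hn : 0 < n) (F : (Fin k → ℕ) → ℝ≥0∞) :
    ∫⁻ y in simplex k, ENNReal.ofReal ((n : ℝ) ^ k) * F (gridCount n y) ≤
      ∑ t ∈ countVectors k n, F t := by
  have hm : ∀ t : Fin k → ℕ, MeasurableSet {y : Fin k → ℝ | gridCount n y = t} := fun t =>
    measurable_gridCount n (measurableSet_singleton t)
  calc ∫⁻ y in simplex k, ENNReal.ofReal ((n : ℝ) ^ k) * F (gridCount n y)
      ≤ ∫⁻ y in simplex k, ∑ t ∈ countVectors k n,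
          {y | gridCount n y = t}.indicator (fun _ => ENNReal.ofReal ((n : ℝ) ^ k) * F t) y := by
        refine setLIntegral_mono' (measurableSet_simplex k) fun y hy => ?_
        refine le_trans ?_ (Finset.single_le_sum (f := fun t =>
          {y | gridCount n y = t}.indicator (fun _ => ENNReal.ofReal ((n : ℝ) ^ k) * F t) y)
          (fun _ _ => zero_le) (gridCount_mem n hy))
        simp
    _ = ∑ t ∈ countVectors k n, ENNReal.ofReal ((n : ℝ) ^ k) * F t *
          volume (simplex k ∩ {y | gridCount n y = t}) := by
        rw [lintegral_finsetSum _ fun t _ => measurable_const.indicator (hm t)]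
        refine Finset.sum_congr rfl fun t _ => ?_
        rw [lintegral_indicator_const (hm t), Measure.restrict_apply (hm t), Set.inter_comm]
    _ ≤ ∑ t ∈ countVectors k n, F t := by
        refine Finset.sum_le_sum fun t _ => ?_
        have hn' : (0 : ℝ) < (n : ℝ) ^ k := by positivity
        calc _ ≤ ENNReal.ofReal ((n : ℝ) ^ k) * F t * ENNReal.ofReal (((n : ℝ) ^ k)⁻¹) := by
              gcongr
              exact volume_gridCount_le hn t
          _ = F t := by
              rw [mul_right_comm, ← ENNReal.ofReal_mul hn'.le, mul_inv_cancel₀ hn'.ne',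
                ENNReal.ofReal_one, one_mul]

/-- Reconciles the inverse cube volume n^k with the rescaling factor (n+k)!/n!. -/
theorem tendsto_pow_mul_factorial_div (k : ℕ) :
    Tendsto (fun n : ℕ => (n : ℝ) ^ k * (n.factorial / (n + k).factorial)) atTop (nhds 1) := by
  induction k with
  | zero =>
    refine tendsto_const_nhds.congr fun n => ?_
    have : (n.factorial : ℝ) ≠ 0 := by positivity
    simp [this]
  | succ k ih =>
    have h : Tendsto (fun n : ℕ => (n : ℝ) / (n + (k + 1 : ℝ))) atTop (nhds 1) :=
      tendsto_natCast_div_add_atTop _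
    have h2 := ih.mul h
    rw [one_mul] at h2
    refine h2.congr fun n => ?_
    rw [← add_assoc n k 1, Nat.factorial_succ]
    push_cast
    have : (n : ℝ) + (k + 1) ≠ 0 := by positivity
    have : ((n + k).factorial : ℝ) ≠ 0 := by positivity
    field_simp
    ring

/-! ### Lower bound by Fatou's lemma -/

theorem ae_continuousWithinAt {k : ℕ} {π : (Fin k → ℝ) → ℝ}
    (h : volume (discontinuitySet π) = 0) :
    ∀ᵐ θ ∂volume.restrict (simplex k), θ ∈ simplex k ∧ ContinuousWithinAt π (simplex k) θ := by
  filter_upwards [ae_restrict_mem (measurableSet_simplex k),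
    ae_restrict_of_ae (measure_eq_zero_iff_ae_notMem.1 h)] with θ hθ hd
  exact ⟨hθ, not_not.1 fun hc => hd ⟨hθ, hc⟩⟩

/-- If the grid counts of every continuity point in `E` eventually lie in `A n`, then the prior
predictive probability of `A n` is asymptotically at least the prior probability of `E`. -/
theorem prior_le_liminf_predictive {k : ℕ} {π : (Fin k → ℝ) → ℝ} (hπ : IsPriorDensity π)
    {B : ℝ} (hB : ∀ θ ∈ simplex k, π θ ≤ B) (hd : volume (discontinuitySet π) = 0)
    {E : Set (Fin k → ℝ)} (hE : NullMeasurableSet E (volume.restrict (simplex k)))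
    {A : ℕ → Set (Fin k → ℕ)}
    (hA : ∀ y ∈ E, y ∈ simplex k → ContinuousWithinAt π (simplex k) y →
      ∀ᶠ n in atTop, gridCount n y ∈ A n) :
    prior π E ≤ liminf (fun n => predictive π n (A n)) atTop := by
  set F : ℕ → (Fin k → ℕ) → ℝ≥0∞ := fun n =>
    (A n).indicator fun t => ENNReal.ofReal (predictiveDensity π n t) with hF
  rw [prior, withDensity_apply']
  calc ∫⁻ y in E, ENNReal.ofReal (π y) ∂volume.restrict (simplex k)
      ≤ ∫⁻ y in E, liminf (fun n : ℕ => ENNReal.ofReal ((n : ℝ) ^ k) * F n (gridCount n y)) atTop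
          ∂volume.restrict (simplex k) := by
        refine lintegral_mono_ae ?_
        filter_upwards [ae_restrict_mem₀ hE, ae_restrict_of_ae (ae_continuousWithinAt hd)]
          with y hyE hy
        -- Pointwise limit of the integrand: for large n the grid count of y lies in `A n`, so the
        -- indicator drops out and π y is left.
        have h1 := (tendsto_pow_mul_factorial_div k).mul (tendsto_scaled_predictiveDensity hπ hB
          hy.1 hy.2 (fun n => gridCount_mem n hy.1) (tendsto_gridCount_div hy.1))
        rw [one_mul] at h1
        refine (Tendsto.liminf_eq ?_).ge
        refine (ENNReal.tendsto_ofReal h1).congr' ?_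
        filter_upwards [hA y hyE hy.1 hy.2] with n hn
        simp only [hF]
        rw [Set.indicator_of_mem hn, ← ENNReal.ofReal_mul (by positivity)]
        congr 1
        have h2 : (n.factorial : ℝ) ≠ 0 := by positivity
        have h3 : ((n + k).factorial : ℝ) ≠ 0 := by positivity
        field_simp
    _ ≤ liminf (fun n : ℕ => ∫⁻ y in E, ENNReal.ofReal ((n : ℝ) ^ k) * F n (gridCount n y)
          ∂volume.restrict (simplex k)) atTop := by
        refine lintegral_liminf_le fun n => Measurable.const_mul ?_ _
        exact (Measurable.of_discrete (f := F n)).comp (measurable_gridCount n)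
    _ ≤ liminf (fun n => predictive π n (A n)) atTop := by
        refine liminf_le_liminf ?_
        filter_upwards [eventually_gt_atTop 0] with n hn
        rw [predictive_apply]
        exact (setLIntegral_le_lintegral _ _).trans (lintegral_gridCount_le hn (F n))

/-! ### Observed frequencies -/

theorem counts_mem {k : ℕ} (n : ℕ) (x : ℕ → Fin (k + 1)) : counts n x ∈ countVectors k n := by
  rw [mem_countVectors]
  have h := Finset.card_eq_sum_card_fiberwise (f := x) (s := Finset.range n) (t := Finset.univ)
    (fun _ _ => Finset.mem_univ _)
  rw [Finset.card_range, Fin.sum_univ_castSucc] at h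
  simp only [counts]
  omega

/-- The strong law of large numbers for the indicators of category j, whose mean is θ j. -/
theorem ae_tendsto_counts_div {k : ℕ} {θ : Fin k → ℝ} (hθ : θ ∈ simplex k)
    {Ω : Type*} [MeasurableSpace Ω] {P : Measure Ω} [IsProbabilityMeasure P]
    {X : ℕ → Ω → Fin (k + 1)} (hX : IsMultinomialSample P X θ) :
    ∀ᵐ ω ∂P, ∀ j, Tendsto (fun n : ℕ => (counts n (fun i => X i ω) j : ℝ) / n) atTop
      (nhds (θ j)) := by
  rw [ae_all_iff]
  intro j
  let f : Fin (k + 1) → ℝ := fun c => if c = j.castSucc then 1 else 0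
  have hf : Measurable f := Measurable.of_discrete
  have hid : ∀ i, IdentDistrib (X i) (X 0) P P := fun i => by
    refine ⟨(hX.measurable i).aemeasurable, (hX.measurable 0).aemeasurable, ?_⟩
    refine Measure.ext_of_singleton fun c => ?_
    rw [Measure.map_apply (hX.measurable i) (measurableSet_singleton c),
      Measure.map_apply (hX.measurable 0) (measurableSet_singleton c)]
    exact (hX.law i c).trans (hX.law 0 c).symm
  have hm : MeasurableSet {ω | X 0 ω = j.castSucc} :=
    hX.measurable 0 (measurableSet_singleton _)
  have he : (fun ω => f (X 0 ω)) = {ω | X 0 ω = j.castSucc}.indicator 1 := by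
    ext ω
    simp [f, Set.indicator_apply]
  have hint : Integrable (fun ω => f (X 0 ω)) P := by
    rw [he]
    exact (integrable_const (1 : ℝ)).indicator hm
  have hmean : ∫ ω, f (X 0 ω) ∂P = θ j := by
    rw [he, integral_indicator_one hm, measureReal_def, hX.law 0]
    simp [cellProb, (hθ.1 j).le]
  have h := strong_law_ae_real (fun i ω => f (X i ω)) hint
    (fun a b hab => (hX.indep.indepFun hab).comp hf hf) (fun i => (hid i).comp hf)
  rw [hmean] at h
  filter_upwards [h] with ω hω
  refine hω.congr fun n => ?_
  simp [f, counts]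

end PriorCheck

/-! ### The two bounds -/

theorem corollary1 {k : ℕ} (π : (Fin k → ℝ) → ℝ) (hπ : PriorCheck.IsPriorDensity π)
    (hA1 : ∃ B : ℝ, 0 < B ∧ ∀ θ ∈ PriorCheck.simplex k, π θ ≤ B)
    (hA2 : volume (PriorCheck.discontinuitySet π) = 0)
    (θtrue : Fin k → ℝ) (hθ : θtrue ∈ PriorCheck.simplex k)
    (hcont : ContinuousWithinAt π (PriorCheck.simplex k) θtrue)
    {Ω : Type*} [MeasurableSpace Ω] (P : Measure Ω) [IsProbabilityMeasure P]
    (X : ℕ → Ω → Fin (k + 1)) (hX : PriorCheck.IsMultinomialSample P X θtrue) :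
    ∀ᵐ ω ∂P,
      PriorCheck.prior π {θ | π θ < π θtrue}
          ≤ liminf (fun n : ℕ =>
              PriorCheck.pValue π n (PriorCheck.counts n fun i => X i ω)) atTop ∧
      liminf (fun n : ℕ => PriorCheck.pValue π n (PriorCheck.counts n fun i => X i ω)) atTop
          ≤ limsup (fun n : ℕ =>
              PriorCheck.pValue π n (PriorCheck.counts n fun i => X i ω)) atTop ∧
      limsup (fun n : ℕ => PriorCheck.pValue π n (PriorCheck.counts n fun i => X i ω)) atTop
          ≤ PriorCheck.prior π {θ | π θ ≤ π θtrue} := by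
  obtain ⟨B, -, hB⟩ := hA1
  filter_upwards [PriorCheck.ae_tendsto_counts_div hθ hX] with ω hω
  have hobs := PriorCheck.tendsto_scaled_predictiveDensity hπ hB hθ hcont
    (fun n => PriorCheck.counts_mem n fun i => X i ω) hω
  have hgrid := fun (y : Fin k → ℝ) (hy : y ∈ PriorCheck.simplex k)
      (hc : ContinuousWithinAt π (PriorCheck.simplex k) y) =>
    PriorCheck.tendsto_scaled_predictiveDensity hπ hB hy hc
      (fun n => PriorCheck.gridCount_mem n hy) (PriorCheck.tendsto_gridCount_div hy)
  have hle : NullMeasurableSet {θ | π θ ≤ π θtrue} (volume.restrict (PriorCheck.simplex k)) :=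
    nullMeasurableSet_le hπ.aemeasurable aemeasurable_const
  refine ⟨?_, liminf_le_limsup, ?_⟩
  · refine PriorCheck.prior_le_liminf_predictive hπ hB hA2
      (nullMeasurableSet_lt hπ.aemeasurable aemeasurable_const) fun y hy hys hyc => ?_
    -- A strict inequality between the limits holds for all large n; the common positive factor
    -- (n+k)!/n! then cancels.
    filter_upwards [(hgrid y hys hyc).eventually_lt hobs hy] with n hn
    exact (lt_of_mul_lt_mul_left hn (by positivity)).le
  -- The upper bound is the lower bound for the complementary events, since limsup (1 - u) = 1 -
  -- liminf u.
  · have hcompl := PriorCheck.prior_le_liminf_predictive hπ hB hA2 hle.compl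
      (A := fun n => {t | PriorCheck.predictiveDensity π n t ≤
        PriorCheck.predictiveDensity π n (PriorCheck.counts n fun i => X i ω)}ᶜ)
      fun y hy hys hyc => by
        filter_upwards [hobs.eventually_lt (hgrid y hys hyc) (not_le.1 hy)] with n hn
        exact not_le.2 (lt_of_mul_lt_mul_left hn (by positivity))
    have hprior : IsProbabilityMeasure (PriorCheck.prior π) := ⟨by
      rw [PriorCheck.prior, withDensity_apply', Measure.restrict_univ, hπ.lintegral_eq_one]⟩
    have hpred : ∀ n, IsProbabilityMeasure (PriorCheck.predictive π n) := fun n =>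
      ⟨PriorCheck.predictive_univ hπ hB n⟩
    have hle' : NullMeasurableSet {θ | π θ ≤ π θtrue} (PriorCheck.prior π) :=
      hle.mono_ac (withDensity_absolutelyContinuous _ _)
    have hp : ∀ n, PriorCheck.pValue π n (PriorCheck.counts n fun i => X i ω) =
        1 - PriorCheck.predictive π n {t | PriorCheck.predictiveDensity π n t ≤
          PriorCheck.predictiveDensity π n (PriorCheck.counts n fun i => X i ω)}ᶜ := fun n => by
      rw [← prob_compl_eq_one_sub (Set.to_countable _).measurableSet, compl_compl]
      rfl
    simp only [hp]
    rw [ENNReal.limsup_const_sub _ _ ENNReal.one_ne_top]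
    refine (tsub_le_tsub_left hcompl 1).trans ?_
    rw [prob_compl_eq_one_sub₀ hle', ENNReal.sub_sub_cancel ENNReal.one_ne_top prob_le_one]
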